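/- Let $X$ and $Y$ be real Banach spaces, and let $X\widehat{\otimes}_\pi Y$ be their projective tensor product, i.e. the completion of $X\otimes Y$ for the norm $\|u\|_\pi=\inf\{\sum_{i}\|x_i\|\,\|y_i\| : u=\sum_{i} x_i\otimes y_i\}$ (finite sums). Every bounded operator $T\colon X\to Y^*$ acts on $X\widehat{\otimes}_\pi Y$ as the bounded linear functional determined by $T(x\otimes y)=T(x)(y)$. Let $K(X,Y^*)$ be the space of compact operators $X\to Y^*$. We say that $K(X,Y^*)$ separates points of $X\widehat{\otimes}_\pi Y$ if for all $u\neq v$ in $X\widehat{\otimes}_\pi Y$ there is $K\in K(X,Y^*)$ with $K(u)\neq K(v)$. The pair $(X,Y^*)$ has the compact approximation property (CAP) if $K(X,Y^*)$ is dense in the space $L(X,Y^*)$ of all bounded operators for the topology of uniform convergence on compact subsets of $X$. For a bounded convex subset $C$ of a Banach space $E$, a point $x\in C$ is a preserved extreme point of $C$ if (the canonical image of) $x$ is an extreme point of the weak$^*$ closure of $C$ in $E^{**}$. Write $C\otimes D=\{x\otimes y: x\in C,\ y\in D\}$. (a) If the pair $(X,Y^*)$ has the CAP, then $K(X,Y^*)$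 separates points of $X\widehat{\otimes}_\pi Y$. (b) Assume that $K(X,Y^*)$ separates points of $X\widehat{\otimes}_\pi Y$. Let $C\subseteq X$ and $D\subseteq Y$ be bounded closed convex sets, and let $z$ be a preserved extreme point of $\overline{\mathrm{conv}}(C\otimes D)\subseteq X\widehat{\otimes}_\pi Y$. Then $z=x\otimes y$ for some $x\in C$ and $y\in D$. If moreover $z\neq 0$, then for all $x\in C$ and $y\in D$ with $z=x\otimes y$, the points $x$ and $y$ are preserved extreme points of $C$ and $D$ respectively. -/

import Mathlib

open scoped TensorProduct CompactConvergenceCLM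

noncomputable section

namespace ProjTensorProduct

variable (X Y : Type*) [NormedAddCommGroup X] [NormedSpace ℝ X]
  [NormedAddCommGroup Y] [NormedSpace ℝ Y]

/-- The algebraic tensor product `X ⊗ Y` of two real normed spaces, as a type synonym that will
carry the projective norm. -/
def AlgTensor : Type _ := X ⊗[ℝ] Y

instance : AddCommGroup (AlgTensor X Y) := inferInstanceAs (AddCommGroup (X ⊗[ℝ] Y))

instance : Module ℝ (AlgTensor X Y) := inferInstanceAs (Module ℝ (X ⊗[ℝ] Y))

variable {X Y}

/-- The elementary tensor `x ⊗ y` in the algebraic tensor product. -/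
def AlgTensor.tmul (x : X) (y : Y) : AlgTensor X Y := TensorProduct.tmul ℝ x y

/-- The values `∑ i, ‖x i‖ * ‖y i‖` over all finite representations `u = ∑ i, x i ⊗ y i`. -/
def reprCosts (u : AlgTensor X Y) : Set ℝ :=
  {r | ∃ (n : ℕ) (x : Fin n → X) (y : Fin n → Y),
    u = ∑ i, AlgTensor.tmul (x i) (y i) ∧ r = ∑ i, ‖x i‖ * ‖y i‖}

/-- The projective norm `‖u‖ = inf {∑ ‖x i‖ ‖y i‖ : u = ∑ x i ⊗ y i}`. -/
def projNorm (u : AlgTensor X Y) : ℝ := sInf (reprCosts u)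

theorem reprCosts_nonneg {u : AlgTensor X Y} {r : ℝ} (hr : r ∈ reprCosts u) : 0 ≤ r := by
  obtain ⟨n, x, y, -, rfl⟩ := hr
  positivity

theorem reprCosts_bddBelow (u : AlgTensor X Y) : BddBelow (reprCosts u) :=
  ⟨0, fun _ hr => reprCosts_nonneg hr⟩

theorem reprCosts_add {u v : AlgTensor X Y} {r s : ℝ} (hr : r ∈ reprCosts u)
    (hs : s ∈ reprCosts v) : r + s ∈ reprCosts (u + v) := by
  obtain ⟨n, x, y, rfl, rfl⟩ := hr
  obtain ⟨m, x', y', rfl, rfl⟩ := hs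
  exact ⟨n + m, Fin.append x x', Fin.append y y', by simp [Fin.sum_univ_add],
    by simp [Fin.sum_univ_add]⟩

theorem reprCosts_smul {u : AlgTensor X Y} {r : ℝ} (a : ℝ) (hr : r ∈ reprCosts u) :
    ‖a‖ * r ∈ reprCosts (a • u) := by
  obtain ⟨n, x, y, rfl, rfl⟩ := hr
  refine ⟨n, fun i => a • x i, y, ?_, ?_⟩
  · rw [Finset.smul_sum]
    exact Finset.sum_congr rfl fun i _ => TensorProduct.smul_tmul' a (x i) (y i)
  · rw [Finset.mul_sum]
    exact Finset.sum_congr rfl fun i _ => by rw [norm_smul, mul_assoc]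

theorem reprCosts_tmul (x : X) (y : Y) : ‖x‖ * ‖y‖ ∈ reprCosts (AlgTensor.tmul x y) :=
  ⟨1, fun _ => x, fun _ => y, by simp, by simp⟩

theorem reprCosts_zero : (0 : ℝ) ∈ reprCosts (0 : AlgTensor X Y) :=
  ⟨0, Fin.elim0, Fin.elim0, by simp, by simp⟩

theorem reprCosts_nonempty (u : AlgTensor X Y) : (reprCosts u).Nonempty := by
  refine TensorProduct.induction_on (motive := fun u : X ⊗[ℝ] Y =>
    (reprCosts (X := X) (Y := Y) u).Nonempty) u ?_ ?_ ?_
  · exact ⟨0, reprCosts_zero⟩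
  · exact fun x y => ⟨_, reprCosts_tmul x y⟩
  · rintro u v ⟨r, hr⟩ ⟨s, hs⟩
    exact ⟨_, reprCosts_add hr hs⟩

theorem projNorm_zero : projNorm (0 : AlgTensor X Y) = 0 :=
  le_antisymm (csInf_le (reprCosts_bddBelow _) reprCosts_zero)
    (le_csInf (reprCosts_nonempty _) fun _ hr => reprCosts_nonneg hr)

theorem projNorm_add_le (u v : AlgTensor X Y) : projNorm (u + v) ≤ projNorm u + projNorm v := by
  rw [← sub_le_iff_le_add]
  refine le_csInf (reprCosts_nonempty u) fun r hr => ?_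
  rw [sub_le_comm]
  refine le_csInf (reprCosts_nonempty v) fun s hs => ?_
  rw [sub_le_iff_le_add, add_comm s]
  exact csInf_le (reprCosts_bddBelow _) (reprCosts_add hr hs)

theorem projNorm_smul_le (a : ℝ) (u : AlgTensor X Y) : projNorm (a • u) ≤ ‖a‖ * projNorm u := by
  rcases eq_or_ne a 0 with rfl | ha
  · rw [zero_smul, projNorm_zero, norm_zero, zero_mul]
  · have ha' : 0 < ‖a‖ := norm_pos_iff.2 ha
    rw [← div_le_iff₀' ha']
    refine le_csInf (reprCosts_nonempty u) fun r hr => ?_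
    rw [div_le_iff₀' ha']
    exact csInf_le (reprCosts_bddBelow _) (reprCosts_smul a hr)

/-- The projective norm as a bundled seminorm. -/
def projSeminorm : Seminorm ℝ (AlgTensor X Y) :=
  Seminorm.ofSMulLE projNorm projNorm_zero projNorm_add_le projNorm_smul_le

instance : SeminormedAddCommGroup (AlgTensor X Y) :=
  fast_instance% AddGroupSeminorm.toSeminormedAddCommGroup (projSeminorm (X := X) (Y := Y)).toAddGroupSeminorm

instance : NormedSpace ℝ (AlgTensor X Y) := ⟨projNorm_smul_le⟩

theorem norm_def (u : AlgTensor X Y) : ‖u‖ = sInf (reprCosts u) := rfl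

variable (X Y) in
/-- The projective tensor product `X ⊗̂_π Y`: the completion of the algebraic tensor product for
the projective norm. -/
abbrev ProjTensor : Type _ := UniformSpace.Completion (AlgTensor X Y)

/-- The elementary tensor `x ⊗ y` in `X ⊗̂_π Y`. -/
def tmul (x : X) (y : Y) : ProjTensor X Y := (AlgTensor.tmul x y : AlgTensor X Y)

/-- The linear form `∑ x i ⊗ y i ↦ ∑ T (x i) (y i)` on the algebraic tensor product induced by an
operator `T : X → Y*`. -/
def algPairingₗ (T : X →L[ℝ] StrongDual ℝ Y) : AlgTensor X Y →ₗ[ℝ] ℝ :=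
  TensorProduct.lift (R := ℝ) T.toLinearMap₁₂

theorem algPairingₗ_tmul (T : X →L[ℝ] StrongDual ℝ Y) (x : X) (y : Y) :
    algPairingₗ T (AlgTensor.tmul x y) = T x y := rfl

theorem norm_algPairingₗ_le (T : X →L[ℝ] StrongDual ℝ Y) (u : AlgTensor X Y) :
    ‖algPairingₗ T u‖ ≤ ‖T‖ * ‖u‖ := by
  rw [norm_def, ← smul_eq_mul, ← Real.sInf_smul_of_nonneg (norm_nonneg T)]
  refine le_csInf (reprCosts_nonempty u).smul_set ?_
  rintro _ ⟨_, ⟨n, x, y, rfl, rfl⟩, rfl⟩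
  simp only [map_sum, algPairingₗ_tmul, smul_eq_mul, Finset.mul_sum]
  refine (norm_sum_le _ _).trans (Finset.sum_le_sum fun i _ => ?_)
  rw [← mul_assoc]
  exact T.le_opNorm₂ (x i) (y i)

/-- The same linear form, as a continuous one. -/
def algPairing (T : X →L[ℝ] StrongDual ℝ Y) : AlgTensor X Y →L[ℝ] ℝ :=
  (algPairingₗ T).mkContinuous ‖T‖ (norm_algPairingₗ_le T)

/-- The functional on `X ⊗̂_π Y` given by an operator `T : X → Y*` under the standard
identification `(X ⊗̂_π Y)* = L(X, Y*)`: the continuous extension of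
`∑ x i ⊗ y i ↦ ∑ T (x i) (y i)`. -/
def pairing (T : X →L[ℝ] StrongDual ℝ Y) : StrongDual ℝ (ProjTensor X Y) :=
  (algPairing T).extend UniformSpace.Completion.toComplL

theorem pairing_tmul (T : X →L[ℝ] StrongDual ℝ Y) (x : X) (y : Y) :
    pairing T (tmul x y) = T x y :=
  ContinuousLinearMap.extend_eq (algPairing T)
    (UniformSpace.Completion.denseRange_coe (α := AlgTensor X Y))
    (UniformSpace.Completion.isUniformInducing_coe (AlgTensor X Y)) (AlgTensor.tmul x y)

variable (X Y) in
/-- `K(X, Y*)`, acting by `(X ⊗̂_π Y)* = L(X, Y*)`, separates the points of `X ⊗̂_π Y`. -/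
def CompactOperatorsSeparate : Prop :=
  ∀ u v : ProjTensor X Y, u ≠ v →
    ∃ K : X →L[ℝ] StrongDual ℝ Y, IsCompactOperator K ∧ pairing K u ≠ pairing K v

variable (X Y) in
/-- The pair `(X, Y)` has the compact approximation property: the compact operators are dense in
`L(X, Y)` for the topology of uniform convergence on compact subsets of `X`. -/
def PairHasCAP : Prop :=
  closure {K : X →L_c[ℝ] Y | IsCompactOperator K} = Set.univ

/-- `x ∈ C` is a preserved extreme point of `C`: the canonical image of `x` in `X**` is an extreme
point of the weak* closure in `X**` of the canonical image of `C`. (For convex `C`, as used here, this closure is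
convex, so extremality through open segments and through midpoints agree.) -/
def IsPreservedExtremePoint (C : Set X) (x : X) : Prop :=
  x ∈ C ∧
    StrongDual.toWeakDual (NormedSpace.inclusionInDoubleDual ℝ X x) ∈
      (closure ((fun c : X => (StrongDual.toWeakDual (NormedSpace.inclusionInDoubleDual ℝ X c) :
        WeakDual ℝ (StrongDual ℝ X))) '' C)).extremePoints ℝ

end ProjTensorProduct

end

noncomputable section

/-! ### Milman's theorem for filters -/

open Filter Topology

/-! (a) Write `u - v` as an absolutely convergent series of elementary tensors and rescale the
factors so that those in `X` tend to zero while those in `Y` stay summable in norm. Then `pairing S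
(u - v)` is bounded by a constant times the supremum of `‖S x‖` over one compact set
(`exists_isCompact_norm_pairing_le`). A functional nonzero at `u - v` is `pairing T` for some
operator `T`. A compact operator close enough to `T` on that set cannot vanish at `u - v`.

(b) Milman's theorem, applied in the weak* compact closure of the convex hull, makes a preserved
extreme point `z` the weak limit of `x_p ⊗ y_p` along an ultrafilter on `C × D`
(`IsPreservedExtremePoint.exists_ultrafilter`). Slicing by a functional whose limit along `y_p` is
nonzero shows that `x_p` has a weak limit `x` in `X` itself, and not merely in the bidual. The other
slice gives `y` in the same way. A compact `K` sends `x_p` to a norm convergent family, so `K x_p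
y_p` tends to `K x y`. Thus `z` and `x ⊗ y` agree on compact operators, and separation gives
equality (`exists_eq_tmul_of_tendsto_weak`). Degenerate limits force `z = 0`.

For the factors, `c ↦ c ⊗ y` with `y ≠ 0` has a slice as left inverse, so its second adjoint is
injective and pulls extremality back (`IsPreservedExtremePoint.of_leftInverse`). -/

/-- A partial converse of the Krein–Milman theorem: an extreme point of a compact convex set which
lies in the closed convex hull of a union lies in the closed convex hull of one of the pieces. -/
theorem mem_closure_convexHull_or_of_mem_extremePoints {V : Type*} [AddCommGroup V] [Module ℝ V]
    [TopologicalSpace V] [IsTopologicalAddGroup V] [ContinuousSMul ℝ V] [T2Space V]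
    {M A B : Set V} {e : V} (hM : IsCompact M) (hMc : Convex ℝ M) (hA : A ⊆ M) (hB : B ⊆ M)
    (he : e ∈ M.extremePoints ℝ) (hAB : e ∈ closure (convexHull ℝ (A ∪ B))) :
    e ∈ closure (convexHull ℝ A) ∨ e ∈ closure (convexHull ℝ B) := by
  rcases A.eq_empty_or_nonempty with rfl | hAn
  · rw [Set.empty_union] at hAB
    exact Or.inr hAB
  rcases B.eq_empty_or_nonempty with rfl | hBn
  · rw [Set.union_empty] at hAB
    exact Or.inl hAB
  have key : ∀ {D : Set V}, D ⊆ M → closure (convexHull ℝ D) ⊆ M := fun hD =>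
    closure_minimal (convexHull_min hD hMc) hM.isClosed
  have hAc := hM.of_isClosed_subset isClosed_closure (key hA)
  have hBc := hM.of_isClosed_subset isClosed_closure (key hB)
  set P := closure (convexHull ℝ A)
  set Q := closure (convexHull ℝ B)
  have hcomp : IsCompact (convexJoin ℝ P Q) := by
    have : convexJoin ℝ P Q =
        (fun p : ℝ × V × V => (1 - p.1) • p.2.1 + p.1 • p.2.2) ''
          (Set.Icc (0 : ℝ) 1 ×ˢ (P ×ˢ Q)) := by
      ext v
      simp only [mem_convexJoin, segment_eq_image, Set.mem_image, Prod.exists, Set.mem_prod]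
      constructor
      · rintro ⟨a, ha, b, hb, t, ht, rfl⟩
        exact ⟨t, a, b, ⟨ht, ha, hb⟩, rfl⟩
      · rintro ⟨t, a, b, ⟨ht, ha, hb⟩, rfl⟩
        exact ⟨a, ha, b, hb, t, ht, rfl⟩
    rw [this]
    exact (isCompact_Icc.prod (hAc.prod hBc)).image (by fun_prop)
  -- The join is compact, hence closed, so it absorbs the closure. This puts `e` on a segment from
  -- `P` to `Q`, both inside `M`.
  have hsub : closure (convexHull ℝ (A ∪ B)) ⊆ convexJoin ℝ P Q := by
    refine closure_minimal ?_ hcomp.isClosed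
    rw [convexHull_union hAn hBn]
    exact convexJoin_mono subset_closure subset_closure
  obtain ⟨a, ha, b, hb, hab⟩ := mem_convexJoin.1 (hsub hAB)
  rcases (mem_extremePoints_iff_forall_segment.1 he).2 a (key hA ha) b (key hB hb) hab with h | h
  · exact Or.inl (h ▸ ha)
  · exact Or.inr (h ▸ hb)

/-- A partial converse of the Krein–Milman theorem, in terms of filters: if an extreme point `e` of a
compact convex set lies in the closed convex hull of the family `ψ` on `S`, then some filter on `S`
eventually avoids, along `ψ`, every closed convex set not containing `e`. -/
theorem exists_filter_of_mem_extremePoints {V α : Type*} [AddCommGroup V] [Module ℝ V]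
    [TopologicalSpace V] [IsTopologicalAddGroup V] [ContinuousSMul ℝ V] [T2Space V]
    {M : Set V} {e : V} {ψ : α → V} {S : Set α} (hM : IsCompact M) (hMc : Convex ℝ M)
    (hS : ψ '' S ⊆ M) (he : e ∈ M.extremePoints ℝ) (heS : e ∈ closure (convexHull ℝ (ψ '' S))) :
    ∃ F : Filter α, F.NeBot ∧ S ∈ F ∧
      ∀ H : Set V, IsClosed H → Convex ℝ H → e ∉ H → ∀ᶠ a in F, ψ a ∉ H := by
  have hSM : ∀ T, ψ '' (S ∩ T) ⊆ M := fun T => (Set.image_mono Set.inter_subset_left).trans hS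
  -- The negligible sets are those whose part in `S` has a closed convex hull missing `e`. The
  -- previous lemma says that they are stable under union.
  let F : Filter α := Filter.comk
    (fun T => e ∉ closure (convexHull ℝ (ψ '' (S ∩ T)))) (by simp)
    (fun T hT T' hTT' h => hT (closure_mono (convexHull_mono (Set.image_mono
      (Set.inter_subset_inter_right S hTT'))) h))
    (fun T hT T' hT' h => by
      rw [Set.inter_union_distrib_left, Set.image_union] at h
      rcases mem_closure_convexHull_or_of_mem_extremePoints hM hMc (hSM T) (hSM T') he h with h | h
      · exact hT h
      · exact hT' h)
  have hFmem : ∀ T, T ∈ F ↔ e ∉ closure (convexHull ℝ (ψ '' (S ∩ Tᶜ))) :=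
    fun T => Filter.mem_comk
  refine ⟨F, ?_, (hFmem S).2 (by simp), fun H hH hHc heH => (hFmem _).2 fun h => heH ?_⟩
  · rwa [Filter.neBot_iff, Ne, ← Filter.empty_mem_iff_bot, hFmem, not_not, Set.compl_empty, Set.inter_univ]
  · refine closure_minimal (convexHull_min ?_ hHc) hH h
    rintro _ ⟨a, ha, rfl⟩
    exact not_not.1 ha.2

/-! ### Preserved extreme points and the bidual -/

namespace ProjTensorProduct

/-- The canonical map of a normed space into its bidual with the weak* topology. -/
def toWeakBidual (E : Type*) [NormedAddCommGroup E] [NormedSpace ℝ E] :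
    E →L[ℝ] WeakDual ℝ (StrongDual ℝ E) where
  toLinearMap := StrongDual.toWeakDual.toLinearMap ∘ₗ
    (NormedSpace.inclusionInDoubleDual ℝ E).toLinearMap
  cont := NormedSpace.Dual.toWeakDual_continuous.comp
    (NormedSpace.inclusionInDoubleDual ℝ E).continuous

theorem isPreservedExtremePoint_iff {E : Type*} [NormedAddCommGroup E] [NormedSpace ℝ E]
    {C : Set E} {x : E} : IsPreservedExtremePoint C x ↔
      x ∈ C ∧ toWeakBidual E x ∈ (closure (toWeakBidual E '' C)).extremePoints ℝ := Iff.rfl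

theorem isCompact_closure_toWeakBidual_image {E : Type*} [NormedAddCommGroup E]
    [NormedSpace ℝ E] {C : Set E} (hC : Bornology.IsBounded C) :
    IsCompact (closure (toWeakBidual E '' C)) := by
  obtain ⟨R, hR⟩ := hC.exists_norm_le
  refine (WeakDual.isCompact_closedBall (𝕜 := ℝ) (0 : StrongDual ℝ (StrongDual ℝ E))
    R).closure_of_subset ?_
  rintro _ ⟨x, hx, rfl⟩
  refine mem_closedBall_zero_iff.2 ?_
  exact (NormedSpace.double_dual_bound ℝ E x).trans (hR x hx)

/-- The canonical map of a normed space into the space of all functions on its dual. -/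
def evalDual (E : Type*) [NormedAddCommGroup E] [NormedSpace ℝ E] :
    E →L[ℝ] (StrongDual ℝ E → ℝ) :=
  ContinuousLinearMap.pi fun f => f

/-- The weak* closure is compact, so its image among functions on the dual is closed and contains
the pointwise closure. The comparison map is linear and injective, so extremality transfers. In the
function space, weak convergence is convergence of coordinates. -/
theorem IsPreservedExtremePoint.evalDual_mem_extremePoints {E : Type*} [NormedAddCommGroup E]
    [NormedSpace ℝ E] {C : Set E} {x : E} (hC : Bornology.IsBounded C)
    (hx : IsPreservedExtremePoint C x) :
    evalDual E x ∈ (closure (evalDual E '' C)).extremePoints ℝ := by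
  rw [isPreservedExtremePoint_iff] at hx
  let Φ : WeakDual ℝ (StrongDual ℝ E) → StrongDual ℝ E → ℝ := fun ψ f => ψ f
  have hΦ : Continuous Φ := WeakDual.coeFn_continuous
  have hsub : closure (evalDual E '' C) ⊆ Φ '' closure (toWeakBidual E '' C) := by
    refine closure_minimal ?_ ((isCompact_closure_toWeakBidual_image hC).image hΦ).isClosed
    rintro _ ⟨c, hc, rfl⟩
    exact ⟨toWeakBidual E c, subset_closure ⟨c, hc, rfl⟩, rfl⟩
  refine ⟨subset_closure ⟨x, hx.1, rfl⟩, fun u hu v hv huv => ?_⟩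
  obtain ⟨ψ, hψ, rfl⟩ := hsub hu
  obtain ⟨ψ', hψ', rfl⟩ := hsub hv
  obtain ⟨a, b, ha, hb, hab, h⟩ := huv
  have : ψ = toWeakBidual E x :=
    hx.2.2 hψ hψ' ⟨a, b, ha, hb, hab, DFunLike.ext _ _ fun f => congrFun h f⟩
  rw [this]
  rfl

/-- A preserved extreme point of the closed convex hull of a bounded set is the weak limit of an
ultrafilter on that set. -/
theorem IsPreservedExtremePoint.exists_ultrafilter {E α : Type*} [NormedAddCommGroup E]
    [NormedSpace ℝ E] {φ : α → E} {S : Set α} {e : E} (hb : Bornology.IsBounded (φ '' S))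
    (he : IsPreservedExtremePoint (closure (convexHull ℝ (φ '' S))) e) :
    ∃ U : Ultrafilter α, S ∈ U ∧
      ∀ f : StrongDual ℝ E, Tendsto (fun a => f (φ a)) U (𝓝 (f e)) := by
  have heC := he.1
  have hCb := (isBounded_convexHull.2 hb).closure
  replace he := he.evalDual_mem_extremePoints hCb
  set J := evalDual E
  set C := closure (convexHull ℝ (φ '' S))
  set M := closure (J '' C)
  have hM : IsCompact M := by
    obtain ⟨R, hR⟩ := hCb.exists_norm_le
    refine (isCompact_univ_pi fun f : StrongDual ℝ E =>
      isCompact_closedBall (0 : ℝ) (‖f‖ * R)).closure_of_subset ?_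
    rintro _ ⟨x, hx, rfl⟩ f -
    exact mem_closedBall_zero_iff.2 (f.le_opNorm_of_le (hR x hx))
  have hMc : Convex ℝ M := ((convex_convexHull ℝ _).closure.linear_image J.toLinearMap).closure
  have hS : (fun a => J (φ a)) '' S ⊆ M := by
    rintro _ ⟨a, ha, rfl⟩
    exact subset_closure ⟨_, subset_closure (subset_convexHull ℝ _ ⟨a, ha, rfl⟩), rfl⟩
  have heS : J e ∈ closure (convexHull ℝ ((fun a => J (φ a)) '' S)) := by
    have h1 : J e ∈ J '' C := ⟨e, heC, rfl⟩
    have h2 := image_closure_subset_closure_image J.continuous h1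
    rwa [show J '' (convexHull ℝ (φ '' S)) = convexHull ℝ (J '' (φ '' S)) from
      J.toLinearMap.image_convexHull _, Set.image_image] at h2
  obtain ⟨F, hne, hSF, hF⟩ := exists_filter_of_mem_extremePoints hM hMc hS he heS
  -- Closed half-spaces missing `J e` are the only convex sets needed. Using `-f` as well gives the
  -- upper bounds.
  have hhalf : ∀ f : StrongDual ℝ E, ∀ c : ℝ, c < f e → ∀ᶠ a in F, c < f (φ a) := by
    intro f c hc
    have := hF {ψ | ψ f ≤ c} (isClosed_le (continuous_apply f) continuous_const)
      (convex_halfSpace_le ⟨fun _ _ => rfl, fun _ _ => rfl⟩ c) (not_le.2 hc)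
    exact this.mono fun a ha => not_le.1 ha
  refine ⟨Ultrafilter.of F, Ultrafilter.of_le F hSF, fun f => ?_⟩
  refine Tendsto.mono_left (tendsto_order.2 ⟨hhalf f, fun c hc => ?_⟩) (Ultrafilter.of_le F)
  filter_upwards [hhalf (-f) (-c) (neg_lt_neg hc)] with a ha
  exact neg_lt_neg_iff.1 ha

/-- The second adjoint of a bounded operator. -/
def weakBidualMap {E P : Type*} [NormedAddCommGroup E] [NormedSpace ℝ E] [NormedAddCommGroup P]
    [NormedSpace ℝ P] (A : E →L[ℝ] P) :
    WeakDual ℝ (StrongDual ℝ E) →L[ℝ] WeakDual ℝ (StrongDual ℝ P) where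
  toFun ψ := StrongDual.toWeakDual (WeakDual.toStrongDual ψ ∘L
    ContinuousLinearMap.precomp ℝ A)
  map_add' _ _ := rfl
  map_smul' _ _ := rfl
  cont := WeakDual.continuous_of_continuous_eval fun f => WeakDual.eval_continuous (f ∘L A)

theorem weakBidualMap_apply {E P : Type*} [NormedAddCommGroup E] [NormedSpace ℝ E]
    [NormedAddCommGroup P] [NormedSpace ℝ P] (A : E →L[ℝ] P)
    (ψ : WeakDual ℝ (StrongDual ℝ E)) (f : StrongDual ℝ P) :
    weakBidualMap A ψ f = ψ (f ∘L A) := rfl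

/-- Preserved extreme points can be pulled back along left invertible operators. -/
theorem IsPreservedExtremePoint.of_leftInverse {E P : Type*} [NormedAddCommGroup E]
    [NormedSpace ℝ E] [NormedAddCommGroup P] [NormedSpace ℝ P] {A : E →L[ℝ] P} {L : P →L[ℝ] E}
    (hLA : ∀ x, L (A x) = x) {C : Set E} {M : Set P} (hCM : Set.MapsTo A C M) {x : E}
    (hx : x ∈ C) (h : IsPreservedExtremePoint M (A x)) : IsPreservedExtremePoint C x := by
  have hinj : Function.Injective (weakBidualMap A) := by
    intro ψ ψ' hψ
    refine DFunLike.ext _ _ fun f => ?_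
    -- Every `f` equals `(f ∘L L) ∘L A`, so the adjoint of `A` is onto and the second adjoint is
    -- injective.
    have h1 := DFunLike.congr_fun hψ (f ∘L L)
    have h2 : (f ∘L L) ∘L A = f := by ext y; simp [hLA]
    rwa [weakBidualMap_apply, weakBidualMap_apply, h2] at h1
  have hmaps : Set.MapsTo (weakBidualMap A) (closure (toWeakBidual E '' C))
      (closure (toWeakBidual P '' M)) := by
    refine Set.MapsTo.closure ?_ (weakBidualMap A).continuous
    rintro _ ⟨c, hc, rfl⟩
    exact ⟨A c, hCM hc, rfl⟩
  rw [isPreservedExtremePoint_iff] at h ⊢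
  refine ⟨hx, subset_closure ⟨x, hx, rfl⟩, fun ψ hψ ψ' hψ' hseg => hinj ?_⟩
  refine h.2.2 (hmaps hψ) (hmaps hψ') ?_
  obtain ⟨a, b, ha, hb, hab, hab'⟩ := hseg
  refine ⟨a, b, ha, hb, hab, ?_⟩
  rw [← map_smul, ← map_smul, ← map_add, hab']
  rfl

end ProjTensorProduct

/-! ### Limits along ultrafilters and weak closedness -/

theorem IsCompact.exists_tendsto_ultrafilter {α T : Type*} [TopologicalSpace T] {K : Set T}
    (hK : IsCompact K) (U : Ultrafilter α) {g : α → T} (hg : ∀ᶠ a in U, g a ∈ K) :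
    ∃ x, Tendsto g U (𝓝 x) :=
  let ⟨x, _, hx⟩ := hK.ultrafilter_le_nhds' (U.map g) hg
  ⟨x, hx⟩

/-- Mazur's theorem: a functional strictly separating `x` from `C` would contradict the convergence.
-/
theorem IsClosed.mem_of_tendsto_weak {E α : Type*} [NormedAddCommGroup E] [NormedSpace ℝ E]
    {C : Set E} (hC : IsClosed C) (hCc : Convex ℝ C) {l : Filter α} [l.NeBot] {φ : α → E}
    (hφ : ∀ᶠ a in l, φ a ∈ C) {x : E}
    (hx : ∀ f : StrongDual ℝ E, Tendsto (fun a => f (φ a)) l (𝓝 (f x))) : x ∈ C := by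
  by_contra h
  obtain ⟨f, u, hfu, hux⟩ := geometric_hahn_banach_closed_point hCc hC h
  exact hux.not_ge (le_of_tendsto (hx f) (hφ.mono fun a ha => (hfu _ ha).le))

/-! ### Duality and slices of the projective tensor product -/

namespace ProjTensorProduct

variable {X Y Z : Type*} [NormedAddCommGroup X] [NormedSpace ℝ X]
  [NormedAddCommGroup Y] [NormedSpace ℝ Y] [NormedAddCommGroup Z] [NormedSpace ℝ Z]

theorem norm_tmul_le (x : X) (y : Y) : ‖tmul x y‖ ≤ ‖x‖ * ‖y‖ := by
  rw [tmul, UniformSpace.Completion.norm_coe, norm_def]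
  exact csInf_le (reprCosts_bddBelow _) (reprCosts_tmul x y)

variable (X Y) in
/-- The canonical bounded bilinear map into the projective tensor product. -/
def tmulL : X →L[ℝ] Y →L[ℝ] ProjTensor X Y :=
  (LinearMap.compr₂ (TensorProduct.mk ℝ X Y :)
    (UniformSpace.Completion.toComplL (𝕜 := ℝ) (E := AlgTensor X Y)).toLinearMap).mkContinuous₂ 1
    fun x y => by rw [one_mul]; exact norm_tmul_le x y

theorem tmulL_apply (x : X) (y : Y) : tmulL X Y x y = tmul x y := rfl

theorem ext_tmul {f g : ProjTensor X Y →L[ℝ] Z}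
    (h : ∀ x y, f (tmul x y) = g (tmul x y)) : f = g := by
  ext u
  refine UniformSpace.Completion.induction_on u (isClosed_eq f.continuous g.continuous) fun a => ?_
  refine TensorProduct.induction_on (motive := fun a : X ⊗[ℝ] Y =>
    f ((show AlgTensor X Y from a : AlgTensor X Y) : ProjTensor X Y) =
      g ((show AlgTensor X Y from a : AlgTensor X Y) : ProjTensor X Y)) a ?_ h ?_
  · exact (map_zero f).trans (map_zero g).symm
  · intro a b ha hb
    have h1 : ∀ F : ProjTensor X Y →L[ℝ] Z, F ((show AlgTensor X Y from a + b : AlgTensor X Y) :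
        ProjTensor X Y) = F ((show AlgTensor X Y from a : AlgTensor X Y) : ProjTensor X Y) +
          F ((show AlgTensor X Y from b : AlgTensor X Y) : ProjTensor X Y) := fun F =>
      (congrArg F (UniformSpace.Completion.coe_add _ _)).trans (map_add F _ _)
    rw [h1, h1, ha, hb]

/-- Every bounded functional on the projective tensor product comes from an operator. -/
theorem pairing_surjective (F : StrongDual ℝ (ProjTensor X Y)) :
    ∃ T : X →L[ℝ] StrongDual ℝ Y, pairing T = F :=
  ⟨ContinuousLinearMap.compL ℝ Y (ProjTensor X Y) ℝ F ∘L tmulL X Y,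
    ext_tmul fun x y => pairing_tmul _ x y⟩

theorem pairing_sub (S T : X →L[ℝ] StrongDual ℝ Y) : pairing (S - T) = pairing S - pairing T :=
  ext_tmul fun x y => by simp [pairing_tmul]

/-- The operator on the projective tensor product induced by a bounded bilinear map. -/
theorem exists_lift [CompleteSpace Z] (B : X →L[ℝ] Y →L[ℝ] Z) :
    ∃ L : ProjTensor X Y →L[ℝ] Z, ∀ x y, L (tmul x y) = B x y := by
  let l : AlgTensor X Y →ₗ[ℝ] Z := TensorProduct.lift (R := ℝ) B.toLinearMap₁₂
  have hl : ∀ u, ‖l u‖ ≤ ‖B‖ * ‖u‖ := by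
    intro u
    rw [norm_def, ← smul_eq_mul, ← Real.sInf_smul_of_nonneg (norm_nonneg B)]
    refine le_csInf (reprCosts_nonempty u).smul_set ?_
    rintro _ ⟨_, ⟨n, x, y, rfl, rfl⟩, rfl⟩
    have : ∀ i, l (AlgTensor.tmul (x i) (y i)) = B (x i) (y i) := fun i => rfl
    simp only [map_sum, this, smul_eq_mul, Finset.mul_sum]
    refine (norm_sum_le _ _).trans (Finset.sum_le_sum fun i _ => ?_)
    rw [← mul_assoc]
    exact B.le_opNorm₂ (x i) (y i)
  exact ⟨(l.mkContinuous ‖B‖ hl).extend UniformSpace.Completion.toComplL, fun x y =>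
    ContinuousLinearMap.extend_eq _ (UniformSpace.Completion.denseRange_coe (α := AlgTensor X Y))
      (UniformSpace.Completion.isUniformInducing_coe (AlgTensor X Y)) (AlgTensor.tmul x y)⟩

/-- Slicing by a functional in the second factor. -/
theorem exists_slice_right [CompleteSpace X] (g : StrongDual ℝ Y) :
    ∃ L : ProjTensor X Y →L[ℝ] X, ∀ x y, L (tmul x y) = g y • x := by
  obtain ⟨L, hL⟩ := exists_lift ((ContinuousLinearMap.lsmul ℝ ℝ).flip.bilinearComp
    (ContinuousLinearMap.id ℝ X) g)
  exact ⟨L, fun x y => by simp [hL]⟩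

/-- Slicing by a functional in the first factor. -/
theorem exists_slice_left [CompleteSpace Y] (f : StrongDual ℝ X) :
    ∃ L : ProjTensor X Y →L[ℝ] Y, ∀ x y, L (tmul x y) = f x • y := by
  obtain ⟨L, hL⟩ := exists_lift ((ContinuousLinearMap.lsmul ℝ ℝ).bilinearComp f
    (ContinuousLinearMap.id ℝ Y))
  exact ⟨L, fun x y => by simp [hL]⟩

/-! ### The compact approximation property gives separation -/

/-- Take a representation of cost below `a * b` and move scalars across each tensor until every
nonzero first factor has norm `a`; the second factors then carry the cost divided by `a`. -/
theorem exists_repr_of_norm_lt {w : AlgTensor X Y} {a b : ℝ} (ha : 0 < a) (hw : ‖w‖ < a * b) :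
    ∃ (n : ℕ) (x : Fin n → X) (y : Fin n → Y), w = ∑ i, AlgTensor.tmul (x i) (y i) ∧
      (∀ i, ‖x i‖ ≤ a) ∧ ∑ i, ‖y i‖ ≤ b := by
  obtain ⟨_, ⟨n, x, y, rfl, rfl⟩, hr⟩ := exists_lt_of_csInf_lt (reprCosts_nonempty w) hw
  refine ⟨n, fun i => (a / ‖x i‖) • x i, fun i => (‖x i‖ / a) • y i, ?_, fun i => ?_, ?_⟩
  · refine Finset.sum_congr rfl fun i _ => ?_
    rcases eq_or_ne (x i) 0 with h | h
    · simp [h, AlgTensor.tmul]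
      rfl
    · have h' : ‖x i‖ ≠ 0 := norm_ne_zero_iff.2 h
      change _ = ((a / ‖x i‖) • x i) ⊗ₜ[ℝ] ((‖x i‖ / a) • y i)
      rw [TensorProduct.smul_tmul, smul_smul, div_mul_div_comm, mul_comm a, div_self (by positivity),
        one_smul]
      rfl
  · rcases eq_or_ne (x i) 0 with h | h
    · simp [h, ha.le]
    · rw [norm_smul, norm_div, norm_norm, div_mul_cancel₀ _ (norm_ne_zero_iff.2 h),
        Real.norm_of_nonneg ha.le]
  · have : ∀ i, ‖(‖x i‖ / a) • y i‖ = ‖x i‖ * ‖y i‖ / a := fun i => by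
      rw [norm_smul, norm_div, norm_norm, Real.norm_of_nonneg ha.le, div_mul_eq_mul_div]
    simp only [this]
    rw [← Finset.sum_div, div_le_iff₀' ha]
    exact hr.le

/-- Each element of the projective tensor product is controlled, uniformly in the operator, by the
values of operators on a compact set. -/
theorem exists_isCompact_norm_pairing_le (u : ProjTensor X Y) :
    ∃ (A : Set X) (M : ℝ), IsCompact A ∧ 0 < M ∧ ∀ (S : X →L[ℝ] StrongDual ℝ Y) (δ : ℝ),
      0 ≤ δ → (∀ x ∈ A, ‖S x‖ ≤ δ) → ‖pairing S u‖ ≤ M * δ := by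
  have hu : u ∈ closure ((UniformSpace.Completion.toCompl (α := AlgTensor X Y)).range :
      Set (ProjTensor X Y)) := by
    rw [AddMonoidHom.coe_range]
    exact UniformSpace.Completion.denseRange_coe u
  obtain ⟨w, hw, -, hwn⟩ := controlled_sum_of_mem_closure_range hu
    (f := fun n => (1 / 2 : ℝ) ^ n * (1 / 2) ^ n) (fun n => by positivity)
  -- The bound `4⁻ⁿ` is split evenly: one half makes the factors in `X` tend to zero, the other
  -- keeps those in `Y` summable. The series gives no bound on `w 0`, hence the constant `‖w 0‖ +
  -- 1`.
  have hwn' : ∀ n, ‖w n‖ < (1 / 2 : ℝ) ^ n * ((‖w 0‖ + 1) * (1 / 2) ^ n) := by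
    intro n
    rcases n.eq_zero_or_pos with rfl | hn
    · simp
    · have h1 : ‖w n‖ < (1 / 2 : ℝ) ^ n * (1 / 2) ^ n := by
        have := hwn n hn
        rwa [show ‖UniformSpace.Completion.toCompl (w n)‖ = ‖w n‖ from
          UniformSpace.Completion.norm_coe (w n)] at this
      refine h1.trans_le ?_
      gcongr
      exact le_mul_of_one_le_left (by positivity) (by linarith [norm_nonneg (w 0)])
  choose N x y hxy hx hy using fun n => exists_repr_of_norm_lt (by positivity) (hwn' n)
  have hlim : Tendsto (fun p : Σ n, Fin (N n) => x p.1 p.2) cofinite (𝓝 0) := by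
    rw [tendsto_zero_iff_norm_tendsto_zero]
    refine squeeze_zero (fun _ => norm_nonneg _) (fun p => hx p.1 p.2) ?_
    have h1 : Tendsto (fun n : ℕ => (1 / 2 : ℝ) ^ n) cofinite (𝓝 0) := by
      rw [Nat.cofinite_eq_atTop]
      exact tendsto_pow_atTop_nhds_zero_of_lt_one (by norm_num) (by norm_num)
    refine h1.comp (Tendsto.cofinite_of_finite_preimage_singleton fun n => ?_)
    refine (Set.finite_range fun i : Fin (N n) => (⟨n, i⟩ : Σ n, Fin (N n))).subset ?_
    rintro ⟨m, i⟩ rfl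
    exact ⟨i, rfl⟩
  -- The compact set is the null family of first factors together with its limit `0`; the `2` bounds
  -- the geometric sum.
  refine ⟨_, (‖w 0‖ + 1) * 2, hlim.isCompact_insert_range_of_cofinite, by positivity,
    fun S δ hδ hS => ?_⟩
  have hterm : ∀ n, ‖pairing S (w n : ProjTensor X Y)‖ ≤ δ * ((‖w 0‖ + 1) * (1 / 2) ^ n) := by
    intro n
    have h1 : pairing S (w n : ProjTensor X Y) = ∑ i, S (x n i) (y n i) := by
      conv_lhs => rw [hxy n]
      rw [← UniformSpace.Completion.coe_toComplL (𝕜 := ℝ), map_sum, map_sum]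
      exact Finset.sum_congr rfl fun i _ => pairing_tmul S _ _
    rw [h1]
    calc ‖∑ i, S (x n i) (y n i)‖ ≤ ∑ i, δ * ‖y n i‖ := by
          refine (norm_sum_le _ _).trans (Finset.sum_le_sum fun i _ => ?_)
          exact (S (x n i)).le_of_opNorm_le (hS _ (Or.inr ⟨⟨n, i⟩, rfl⟩)) _
      _ = δ * ∑ i, ‖y n i‖ := (Finset.mul_sum _ _ _).symm
      _ ≤ _ := by gcongr; exact hy n
  refine le_of_tendsto (((pairing S).continuous.tendsto u).comp hw).norm
    (Eventually.of_forall fun n => ?_)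
  simp only [Function.comp_apply, map_sum]
  calc _ ≤ ∑ i ∈ Finset.range (n + 1), δ * ((‖w 0‖ + 1) * (1 / 2) ^ i) :=
        (norm_sum_le _ _).trans (Finset.sum_le_sum fun i _ => hterm i)
    _ = (‖w 0‖ + 1) * (∑ i ∈ Finset.range (n + 1), (1 / 2 : ℝ) ^ i) * δ := by
        simp only [Finset.mul_sum, Finset.sum_mul]
        exact Finset.sum_congr rfl fun i _ => by ring
    _ ≤ _ := by gcongr; exact sum_geometric_two_le _

theorem PairHasCAP.compactOperatorsSeparate (h : PairHasCAP X (StrongDual ℝ Y)) :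
    CompactOperatorsSeparate X Y := by
  intro u v huv
  obtain ⟨F, hF⟩ := SeparatingDual.exists_ne_zero (R := ℝ) (sub_ne_zero.2 huv)
  obtain ⟨T, rfl⟩ := pairing_surjective F
  obtain ⟨A, M, hA, hM, hAM⟩ := exists_isCompact_norm_pairing_le (u - v)
  set c := ‖pairing T (u - v)‖
  have hc : 0 < c := norm_pos_iff.2 hF
  let T' : X →L_c[ℝ] StrongDual ℝ Y := T
  have hT : T' ∈ closure {K : X →L_c[ℝ] StrongDual ℝ Y | IsCompactOperator K} := by
    rw [show closure _ = _ from h]; trivial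
  have hnhds : {K : X →L_c[ℝ] StrongDual ℝ Y | ∀ x ∈ A, K x ∈ Metric.ball 0 (c / (2 * M))} ∈
      𝓝 (0 : X →L_c[ℝ] StrongDual ℝ Y) :=
    CompactConvergenceCLM.hasBasis_nhds_zero.mem_of_mem (i := (A, Metric.ball 0 (c / (2 * M))))
      ⟨hA, Metric.ball_mem_nhds _ (by positivity)⟩
  have hsub : Tendsto (fun K : X →L_c[ℝ] StrongDual ℝ Y => K - T') (𝓝 T') (𝓝 0) := by
    have : Continuous fun K : X →L_c[ℝ] StrongDual ℝ Y => K - T' := by fun_prop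
    simpa using this.tendsto T'
  obtain ⟨K, hKA, hK⟩ := mem_closure_iff_nhds.1 hT _ (hsub hnhds)
  let K' : X →L[ℝ] StrongDual ℝ Y := K
  refine ⟨K', hK, fun heq => ?_⟩
  -- If `K'` did not separate `u` and `v`, the left side would be `c` and the bound `c / 2`.
  have h1 := hAM (K' - T) (c / (2 * M)) (by positivity) fun x hx =>
    (mem_ball_zero_iff.1 (hKA x hx)).le
  have h2 : pairing K' (u - v) = 0 := by rw [map_sub, heq, sub_self]
  rw [pairing_sub, sub_apply, h2, zero_sub, norm_neg] at h1
  have h3 : M * (c / (2 * M)) = c / 2 := by field_simp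
  rw [h3] at h1
  linarith

end ProjTensorProduct

/-! ### Weak limits of elementary tensors and their factors -/

namespace ProjTensorProduct

variable {X Y : Type*} [NormedAddCommGroup X] [NormedSpace ℝ X]
  [NormedAddCommGroup Y] [NormedSpace ℝ Y]

theorem isBounded_image2_tmul {C : Set X} {D : Set Y} (hC : Bornology.IsBounded C)
    (hD : Bornology.IsBounded D) : Bornology.IsBounded (Set.image2 tmul C D) := by
  obtain ⟨R, hR⟩ := hC.exists_norm_le
  obtain ⟨R', hR'⟩ := hD.exists_norm_le
  refine isBounded_iff_forall_norm_le.2 ⟨R * R', ?_⟩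
  rintro _ ⟨x, hx, y, hy, rfl⟩
  exact (norm_tmul_le x y).trans (mul_le_mul (hR x hx) (hR' y hy) (norm_nonneg _)
    ((norm_nonneg _).trans (hR x hx)))

/-- If compact operators separate points, weak limits of elementary tensors from a product of
bounded closed convex sets are elementary tensors from that product. -/
theorem exists_eq_tmul_of_tendsto_weak [CompleteSpace X] [CompleteSpace Y]
    (hsep : CompactOperatorsSeparate X Y) {C : Set X} {D : Set Y}
    (hCb : Bornology.IsBounded C) (hC : IsClosed C) (hCc : Convex ℝ C)
    (hDb : Bornology.IsBounded D) (hD : IsClosed D) (hDc : Convex ℝ D)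
    {z : ProjTensor X Y} {U : Ultrafilter (X × Y)} (hU : C ×ˢ D ∈ U)
    (hz : ∀ f : StrongDual ℝ (ProjTensor X Y),
      Tendsto (fun p : X × Y => f (tmul p.1 p.2)) U (𝓝 (f z))) :
    ∃ x ∈ C, ∃ y ∈ D, z = tmul x y := by
  obtain ⟨R, hR⟩ := hCb.exists_norm_le
  obtain ⟨R', hR'⟩ := hDb.exists_norm_le
  have hUC : ∀ᶠ p : X × Y in U, p.1 ∈ C := mem_of_superset hU fun p hp => hp.1
  have hUD : ∀ᶠ p : X × Y in U, p.2 ∈ D := mem_of_superset hU fun p hp => hp.2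
  have hex : ∀ f : StrongDual ℝ X, ∃ c, Tendsto (fun p : X × Y => f p.1) U (𝓝 c) := fun f =>
    (isCompact_closedBall (0 : ℝ) (‖f‖ * R)).exists_tendsto_ultrafilter U
      (hUC.mono fun p hp => mem_closedBall_zero_iff.2 (f.le_opNorm_of_le (hR _ hp)))
  have hey : ∀ g : StrongDual ℝ Y, ∃ c, Tendsto (fun p : X × Y => g p.2) U (𝓝 c) := fun g =>
    (isCompact_closedBall (0 : ℝ) (‖g‖ * R')).exists_tendsto_ultrafilter U
      (hUD.mono fun p hp => mem_closedBall_zero_iff.2 (g.le_opNorm_of_le (hR' _ hp)))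
  choose a ha using hex
  choose b hb using hey
  have hzK : ∀ K : X →L[ℝ] StrongDual ℝ Y,
      Tendsto (fun p : X × Y => K p.1 p.2) U (𝓝 (pairing K z)) := fun K =>
    (hz (pairing K)).congr fun p => pairing_tmul K _ _
  -- Compactness upgrades weak to norm convergence of `K p.1`, so on the bounded set `D` its value
  -- at `p.2` may be replaced by that of the limit `h`.
  have hKlim : ∀ K : X →L[ℝ] StrongDual ℝ Y, IsCompactOperator K →
      ∃ h, Tendsto (fun p : X × Y => K p.1) U (𝓝 h) ∧ pairing K z = b h := by
    intro K hK
    obtain ⟨h, hh⟩ := (hK.isCompact_closure_image_of_bounded (f := K.toLinearMap)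
      hCb).exists_tendsto_ultrafilter U
        (hUC.mono fun p hp => subset_closure (Set.mem_image_of_mem K hp))
    refine ⟨h, hh, tendsto_nhds_unique (hzK K) ?_⟩
    have h0 : Tendsto (fun p : X × Y => (K p.1 - h) p.2) U (𝓝 0) := by
      have h1 : Tendsto (fun p : X × Y => ‖K p.1 - h‖ * R') U (𝓝 0) := by
        simpa using (tendsto_sub_nhds_zero_iff.2 hh).norm.mul_const R'
      exact squeeze_zero_norm' (hUD.mono fun p hp =>
        (K p.1 - h).le_opNorm_of_le (hR' _ hp)) h1
    simpa using h0.add (hb h)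
  have hCmem : ∀ x, (∀ f : StrongDual ℝ X, a f = f x) → x ∈ C := fun x hx =>
    hC.mem_of_tendsto_weak hCc hUC fun f => hx f ▸ ha f
  have hDmem : ∀ y, (∀ g : StrongDual ℝ Y, b g = g y) → y ∈ D := fun y hy =>
    hD.mem_of_tendsto_weak hDc hUD fun g => hy g ▸ hb g
  obtain ⟨p₀, hp₀⟩ := U.nonempty_of_mem hU
  have hz0 : (∀ K : X →L[ℝ] StrongDual ℝ Y, IsCompactOperator K → pairing K z = 0) → z = 0 := by
    intro h
    by_contra hne
    obtain ⟨K, hK, hKz⟩ := hsep z 0 hne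
    exact hKz (by rw [h K hK, map_zero])
  by_cases hb0 : ∀ g, b g = 0
  -- Here the second factors tend weakly to `0`, so `0 ∈ D`, and `z` is killed by all compact
  -- operators; any first factor will do.
  · refine ⟨p₀.1, hp₀.1, 0, hDmem 0 fun g => by rw [hb0, map_zero], ?_⟩
    rw [← tmulL_apply, map_zero]
    refine hz0 fun K hK => ?_
    obtain ⟨h, -, hKh⟩ := hKlim K hK
    rw [hKh, hb0]
  push Not at hb0
  obtain ⟨g, hg⟩ := hb0
  obtain ⟨L, hL⟩ := exists_slice_right (X := X) g
  obtain ⟨x, hx⟩ : ∃ x, ∀ f : StrongDual ℝ X, a f = f x := by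
    -- Testing `z` on `f ∘L L` gives `f (L z) = b g * a f`, so `a` is evaluation at a point of `X`.
    refine ⟨(b g)⁻¹ • L z, fun f => ?_⟩
    have h1 := hz (f ∘L L)
    simp only [ContinuousLinearMap.comp_apply, hL, map_smul, smul_eq_mul] at h1
    rw [map_smul, smul_eq_mul, tendsto_nhds_unique h1 ((hb g).mul (ha f)),
      inv_mul_cancel_left₀ hg]
  have hKx : ∀ K : X →L[ℝ] StrongDual ℝ Y, IsCompactOperator K → pairing K z = b (K x) := by
    intro K hK
    obtain ⟨h, hh, hKh⟩ := hKlim K hK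
    suffices h = K x by rw [hKh, this]
    ext y
    -- The norm limit `h` is identified pointwise on `Y`, since `K.flip y` is a functional on `X`.
    have h1 := ha (K.flip y)
    rw [hx] at h1
    exact tendsto_nhds_unique (((ContinuousLinearMap.apply ℝ ℝ y).continuous.tendsto h).comp hh) h1
  by_cases hx0 : x = 0
  · refine ⟨x, hCmem x hx, p₀.2, hp₀.2, ?_⟩
    rw [← tmulL_apply, hx0, map_zero, zero_apply]
    refine hz0 fun K hK => ?_
    rw [hKx K hK, hx0, map_zero]
    exact tendsto_nhds_unique (hb 0) (by simp)
  obtain ⟨f, hf⟩ := SeparatingDual.exists_ne_zero (R := ℝ) hx0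
  obtain ⟨L', hL'⟩ := exists_slice_left (Y := Y) f
  obtain ⟨y, hy⟩ : ∃ y, ∀ g : StrongDual ℝ Y, b g = g y := by
    refine ⟨(f x)⁻¹ • L' z, fun g => ?_⟩
    have h1 := hz (g ∘L L')
    simp only [ContinuousLinearMap.comp_apply, hL', map_smul, smul_eq_mul] at h1
    rw [map_smul, smul_eq_mul, tendsto_nhds_unique h1 ((ha f).mul (hb g)), hx,
      inv_mul_cancel_left₀ hf]
  refine ⟨x, hCmem x hx, y, hDmem y hy, ?_⟩
  by_contra hne
  obtain ⟨K, hK, hKz⟩ := hsep _ _ hne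
  exact hKz (by rw [hKx K hK, hy, pairing_tmul])

/-- If a nonzero elementary tensor is a preserved extreme point of a set containing `C ⊗ y`, then
its first factor is a preserved extreme point of `C`. -/
theorem IsPreservedExtremePoint.of_tmul_left [CompleteSpace X] {C : Set X}
    {M : Set (ProjTensor X Y)} {x : X} {y : Y} (hy : y ≠ 0) (hM : ∀ c ∈ C, tmul c y ∈ M)
    (hx : x ∈ C) (h : IsPreservedExtremePoint M (tmul x y)) : IsPreservedExtremePoint C x := by
  obtain ⟨g, hg⟩ := SeparatingDual.exists_eq_one (R := ℝ) hy
  obtain ⟨L, hL⟩ := exists_slice_right (X := X) g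
  exact of_leftInverse (A := (tmulL X Y).flip y) (L := L)
    (fun c => (hL c y).trans (by rw [hg, one_smul])) hM hx h

/-- If a nonzero elementary tensor is a preserved extreme point of a set containing `x ⊗ D`, then
its second factor is a preserved extreme point of `D`. -/
theorem IsPreservedExtremePoint.of_tmul_right [CompleteSpace Y] {D : Set Y}
    {M : Set (ProjTensor X Y)} {x : X} {y : Y} (hx : x ≠ 0) (hM : ∀ d ∈ D, tmul x d ∈ M)
    (hy : y ∈ D) (h : IsPreservedExtremePoint M (tmul x y)) : IsPreservedExtremePoint D y := by
  obtain ⟨f, hf⟩ := SeparatingDual.exists_eq_one (R := ℝ) hx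
  obtain ⟨L, hL⟩ := exists_slice_left (Y := Y) f
  exact of_leftInverse (A := tmulL X Y x) (L := L)
    (fun d => (hL x d).trans (by rw [hf, one_smul])) hM hy h

end ProjTensorProduct

end

theorem theorem1p1 {X Y : Type*} [NormedAddCommGroup X] [NormedSpace ℝ X] [CompleteSpace X]
    [NormedAddCommGroup Y] [NormedSpace ℝ Y] [CompleteSpace Y] :
    (ProjTensorProduct.PairHasCAP X (StrongDual ℝ Y) →
      ProjTensorProduct.CompactOperatorsSeparate X Y) ∧
    (ProjTensorProduct.CompactOperatorsSeparate X Y →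
      ∀ (C : Set X) (D : Set Y),
        Bornology.IsBounded C → IsClosed C → Convex ℝ C →
        Bornology.IsBounded D → IsClosed D → Convex ℝ D →
        ∀ z : ProjTensorProduct.ProjTensor X Y,
          ProjTensorProduct.IsPreservedExtremePoint
            (closure (convexHull ℝ (Set.image2 ProjTensorProduct.tmul C D))) z →
          (∃ x ∈ C, ∃ y ∈ D, z = ProjTensorProduct.tmul x y) ∧
          (z ≠ 0 → ∀ x ∈ C, ∀ y ∈ D, z = ProjTensorProduct.tmul x y →
            ProjTensorProduct.IsPreservedExtremePoint C x ∧
              ProjTensorProduct.IsPreservedExtremePoint D y)) := by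
  refine ⟨fun h => h.compactOperatorsSeparate, fun hsep C D hCb hC hCc hDb hD hDc z hz => ⟨?_, ?_⟩⟩
  · have hb := ProjTensorProduct.isBounded_image2_tmul hCb hDb
    rw [← Set.image_prod] at hz hb
    obtain ⟨U, hU, hUz⟩ := hz.exists_ultrafilter hb
    exact ProjTensorProduct.exists_eq_tmul_of_tendsto_weak hsep hCb hC hCc hDb hD hDc hU hUz
  · rintro hz0 x hx y hy rfl
    have hmem : ∀ c ∈ C, ∀ d ∈ D, ProjTensorProduct.tmul c d ∈
        closure (convexHull ℝ (Set.image2 ProjTensorProduct.tmul C D)) := fun c hc d hd =>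
      subset_closure (subset_convexHull ℝ _ ⟨c, hc, d, hd, rfl⟩)
    refine ⟨hz.of_tmul_left ?_ (fun c hc => hmem c hc y hy) hx,
      hz.of_tmul_right ?_ (fun d hd => hmem x hx d hd) hy⟩
    · rintro rfl
      exact hz0 (by rw [← ProjTensorProduct.tmulL_apply, map_zero])
    · rintro rfl
      exact hz0 (by rw [← ProjTensorProduct.tmulL_apply, map_zero,
        zero_apply])
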